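/- **Definitions.** Let $\lambda_{\max}\in(0,\infty]$. A function $\psi:[0,\lambda_{\max})\to[0,\infty)$ is *CGF-like* if it is twice continuously differentiable and strictly convex with $\psi(0)=\psi'(0)=0$ and $\psi''(0)>0$; it is *super-Gaussian* if $\lambda\mapsto\psi(\lambda)/\lambda^2$ is non-decreasing on $(0,\lambda_{\max})$. We assume throughout that $\sup_{\lambda}\psi'(\lambda)=\infty$. Write $\psi^*(u)=\sup_{\lambda\in[0,\lambda_{\max})}(u\lambda-\psi(\lambda))$ for $u\ge 0$, and $(\psi^*)^{-1}:[0,\infty)\to[0,\infty)$ for the inverse of $\psi^*:[0,\infty)\to[0,\infty)$. Let $d\ge 1$, let $\|\cdot\|$ be the Euclidean norm, and let $\mathbb S^{d-1}$ be the unit sphere of $\mathbb R^d$. Let $(S_t)_{t\in\mathbb N_0}$ and $(V_t)_{t\in\mathbb N_0}$ be processes valued in $\mathbb R^d$ and in the positive semi-definite $d\times d$ matrices respectively, adapted to a filtration $(\mathcal F_t)_{t\in\mathbb N_0}$ on a probability space. The process $(S_t,V_t)$ is *sub-$\psi$* if for all $\nu\in\mathbb S^{d-1}$ and $\lambda\in[0,\lambda_{\max})$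 there is a non-negative supermartingale $(L_t)$ with respect to $(\mathcal F_t)$ with $\mathbb E L_0\le 1$ and, almost surely, $\exp\{\lambda\langle\nu,S_t\rangle-\psi(\lambda)\langle\nu,V_t\nu\rangle\}\le L_t$ for all $t$. For positive semi-definite $V$ and $\rho>0$ let $V\vee\rho I$ be the matrix with the same eigenvectors as $V$ and with each eigenvalue $\gamma$ replaced by $\max(\gamma,\rho)$. Let $\gamma_{\min},\gamma_{\max}$ denote the smallest and largest eigenvalue, and $\kappa=\gamma_{\max}/\gamma_{\min}$. Let $N_{d-1}(r)$ be the smallest number of points of $\mathbb S^{d-1}$ such that every point of $\mathbb S^{d-1}$ is within Euclidean distance $r$ of one of them. **Theorem.** Let $(S_t,V_t)$ be an $\mathbb R^d$-valued sub-$\psi$ process for a CGF-like $\psi$ with $\sup\psi'=\infty$. Let $\alpha,\beta>1$, $\rho>0$, $\epsilon,\delta\in(0,1)$, and let $h:[0,\infty)\to[0,\infty)$ be non-decreasing with $\sum_{k\in\mathbb N_0}h(k)^{-1}\le 1$. Put $$L_\rho(V)=\log h\!\left(\log_\alpha\frac{\gamma_{\max}(V\vee\rho I)}{\rho}\right)+\log\!\left(\frac1\delta\cdot\frac{1}{1-\beta^{-1}}\right)+\log\!\left(\beta\sqrt{\kappa(V\vee\rho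 I)}\;N_{d-1}\!\left(\frac{\epsilon}{\beta\sqrt{\kappa(V\vee\rho I)}}\right)\right).$$ (i) If $\psi$ is super-Gaussian, then $$\mathbb P\left(\exists t\ge 0:\ \|(V_t\vee\rho I)^{-1/2}S_t\|\ \ge\ \frac{\sqrt{\gamma_{\min}(V_t\vee\rho I)}}{1-\epsilon}\,(\psi^*)^{-1}\!\left(\frac{\alpha}{\gamma_{\min}(V_t\vee\rho I)}L_\rho(V_t)\right)\right)\le\delta .$$ (ii) For every such $\psi$, super-Gaussian or not, with $W_t:=V_t\vee\rho I$, $$\mathbb P\left(\exists t\ge 0:\ \|W_t^{-1/2}S_t\|\ \ge\ \sup_{\nu\in\mathbb S^{d-1}}\frac{\sqrt{\langle\nu,W_t\nu\rangle}}{1-\epsilon}\,(\psi^*)^{-1}\!\left(\frac{\alpha}{\langle\nu,W_t\nu\rangle}L_\rho(V_t)\right)\right)\le\delta .$$ -/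

import Mathlib

open MeasureTheory
open scoped ENNReal

namespace SelfNormalized

noncomputable section

/-! ### CGF-like functions -/

/-- The half-open interval `[0, lmax)` of real numbers, where `lmax` may be `∞`. -/
def dom (lmax : EReal) : Set ℝ := {x : ℝ | 0 ≤ x ∧ (x : EReal) < lmax}

/-- `ψ : [0, lmax) → [0, ∞)` is CGF-like: it is twice continuously differentiable (one-sided
derivatives at `0`), strictly convex, `ψ(0) = ψ'(0) = 0` and `ψ''(0) > 0`.
The values of `ψ` outside `[0, lmax)` are irrelevant. -/
structure IsCGFLike (lmax : EReal) (ψ : ℝ → ℝ) : Prop where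
  lmax_pos : 0 < lmax
  nonneg : ∀ x ∈ dom lmax, 0 ≤ ψ x
  contDiffOn : ContDiffOn ℝ 2 ψ (dom lmax)
  strictConvexOn : StrictConvexOn ℝ (dom lmax) ψ
  zero : ψ 0 = 0
  deriv_zero : derivWithin ψ (dom lmax) 0 = 0
  deriv2_zero : 0 < iteratedDerivWithin 2 ψ (dom lmax) 0

/-- `sup_{[0, lmax)} ψ' = ∞`. -/
def DerivUnbounded (lmax : EReal) (ψ : ℝ → ℝ) : Prop :=
  ¬ BddAbove (derivWithin ψ (dom lmax) '' dom lmax)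

/-- `ψ` is super-Gaussian: `x ↦ ψ(x) / x²` is non-decreasing on `(0, lmax)`. -/
def IsSuperGaussian (lmax : EReal) (ψ : ℝ → ℝ) : Prop :=
  MonotoneOn (fun x => ψ x / x ^ 2) (dom lmax \ {0})

/-- The convex conjugate `ψ*(u) = sup_{x ∈ [0, lmax)} (u x - ψ(x))`. -/
def conj (lmax : EReal) (ψ : ℝ → ℝ) (u : ℝ) : ℝ :=
  sSup ((fun x => u * x - ψ x) '' dom lmax)

/-- The inverse `(ψ*)⁻¹ : [0, ∞) → [0, ∞)` of the convex conjugate `ψ* : [0, ∞) → [0, ∞)`,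
which is a bijection when `ψ` is CGF-like with unbounded derivative. -/
def conjInv (lmax : EReal) (ψ : ℝ → ℝ) (y : ℝ) : ℝ :=
  Function.invFunOn (conj lmax ψ) (Set.Ici 0) y

/-! ### Sub-`ψ` processes in discrete time -/

/-- The scalar process `(S, V)` is sub-`ψ` with respect to the filtration `ℱ`: for each
`x ∈ [0, lmax)`, `exp(x S_t - ψ(x) V_t)` is almost surely dominated by a nonnegative
supermartingale whose initial expectation is at most one. -/
structure IsSubPsiScalar {Ω : Type*} {mΩ : MeasurableSpace Ω} (μ : Measure Ω)
    (ℱ : Filtration ℕ mΩ) (lmax : EReal) (ψ : ℝ → ℝ) (S V : ℕ → Ω → ℝ) : Prop where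
  adapted_fst : StronglyAdapted ℱ S
  adapted_snd : StronglyAdapted ℱ V
  nonneg : ∀ t ω, 0 ≤ V t ω
  dominated : ∀ x ∈ dom lmax, ∃ L : ℕ → Ω → ℝ,
    Supermartingale L ℱ μ ∧ (∀ t, ∀ᵐ ω ∂μ, 0 ≤ L t ω) ∧ ∫ ω, L 0 ω ∂μ ≤ 1 ∧
      ∀ t, ∀ᵐ ω ∂μ, Real.exp (x * S t ω - ψ x * V t ω) ≤ L t ω

/-- The quadratic form `⟨ν, V ν⟩`. -/
def quadForm {d : ℕ} (V : Matrix (Fin d) (Fin d) ℝ) (ν : EuclideanSpace ℝ (Fin d)) : ℝ :=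
  inner ℝ ν (Matrix.toEuclideanLin V ν)

/-- The `ℝᵈ`-valued process `S`, with variance proxy `V` valued in the positive semi-definite
`d × d` matrices, is sub-`ψ` with respect to `ℱ`: for every unit vector `ν` the projected process
`(⟨ν, S_t⟩, ⟨ν, V_t ν⟩)` is sub-`ψ`. -/
structure IsSubPsi {Ω : Type*} {mΩ : MeasurableSpace Ω} (μ : Measure Ω)
    (ℱ : Filtration ℕ mΩ) (lmax : EReal) (ψ : ℝ → ℝ) {d : ℕ}
    (S : ℕ → Ω → EuclideanSpace ℝ (Fin d)) (V : ℕ → Ω → Matrix (Fin d) (Fin d) ℝ) : Prop where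
  adapted_fst : StronglyAdapted ℱ S
  adapted_snd : StronglyAdapted ℱ V
  posSemidef : ∀ t ω, (V t ω).PosSemidef
  projected : ∀ ν ∈ Metric.sphere (0 : EuclideanSpace ℝ (Fin d)) 1,
    IsSubPsiScalar μ ℱ lmax ψ (fun t ω => inner ℝ ν (S t ω)) (fun t ω => quadForm (V t ω) ν)

/-! ### Spectral quantities of symmetric matrices -/

/-- The smallest eigenvalue of a symmetric matrix. -/
def gammaMin {d : ℕ} (V : Matrix (Fin d) (Fin d) ℝ) : ℝ := sInf (spectrum ℝ V)

/-- The largest eigenvalue of a symmetric matrix. -/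
def gammaMax {d : ℕ} (V : Matrix (Fin d) (Fin d) ℝ) : ℝ := sSup (spectrum ℝ V)

/-- The condition number. -/
def condNum {d : ℕ} (V : Matrix (Fin d) (Fin d) ℝ) : ℝ := gammaMax V / gammaMin V

/-- `V ∨ ρ I`: every eigenvalue `γ` of the symmetric matrix `V` is replaced by `max γ ρ`, the
eigenvectors are kept (spectral functional calculus). -/
def clip {d : ℕ} (V : Matrix (Fin d) (Fin d) ℝ) (ρ : ℝ) : Matrix (Fin d) (Fin d) ℝ :=
  cfc (fun x : ℝ => max x ρ) V

/-- `V^{-1/2}` for a symmetric positive definite matrix `V` (spectral functional calculus). -/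
def invSqrt {d : ℕ} (V : Matrix (Fin d) (Fin d) ℝ) : Matrix (Fin d) (Fin d) ℝ :=
  cfc (fun x : ℝ => (Real.sqrt x)⁻¹) V

/-- The self-normalized quantity `‖(V ∨ ρ I)^{-1/2} s‖` (Euclidean norm). -/
def selfNorm {d : ℕ} (ρ : ℝ) (V : Matrix (Fin d) (Fin d) ℝ) (s : EuclideanSpace ℝ (Fin d)) : ℝ :=
  ‖Matrix.toEuclideanLin (invSqrt (clip V ρ)) s‖

/-- The smallest cardinality of an `r`-cover of the Euclidean unit sphere of `ℝᵈ` by closed balls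
centered on the sphere. -/
def sphereCov (d : ℕ) (r : ℝ) : ℕ :=
  (Metric.coveringNumber r.toNNReal (Metric.sphere (0 : EuclideanSpace ℝ (Fin d)) 1)).toNat

/-- The function `L_ρ`. -/
def Lfun {d : ℕ} (α β ρ ε δ : ℝ) (h : ℝ → ℝ) (V : Matrix (Fin d) (Fin d) ℝ) : ℝ :=
  Real.log (h (Real.logb α (gammaMax (clip V ρ) / ρ)))
    + Real.log (1 / δ * (1 / (1 - β⁻¹)))
    + Real.log (β * Real.sqrt (condNum (clip V ρ))
        * sphereCov d (ε / (β * Real.sqrt (condNum (clip V ρ)))))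

end

end SelfNormalized

namespace SelfNormalized

/-! ### The convex conjugate of a CGF-like function -/

section Conj

variable {lmax : EReal} {ψ : ℝ → ℝ}

/-! The proof is a line-crossing argument with a union bound over a two-parameter geometric grid.
For a fixed unit vector `ν` and fixed `x`, Ville's inequality bounds by `exp (-y)` the probability
that `x⟨ν, S_t⟩ - ψ(x)⟨ν, V_t ν⟩` ever reaches `y`.

Let `W = clip V ρ`. The ratio `⟨ν, s⟩ / √⟨ν, Wν⟩` is maximal along `W⁻¹s`, with value `‖W^{-1/2}s‖`,
and unit vectors within `ε / √κ(W)` of that direction lose at most a factor `1 - ε`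
(`exists_direction`). The mesh needed depends on the random `κ`, so there is one net for each range
`[β^j, β^(j+1))` of `√κ`. The variance `q = ⟨ν, Wν⟩` is likewise rounded down to `ρ α^k`, and each
cell `(j, k)` gets a deterministic `x`, optimal for that variance. The levels are set so that the
failure probabilities sum to at most `δ` (`tsum_exp_neg_cellLevel_le`).

If the self-normalized norm exceeds the threshold of every direction, some line is crossed
(`exists_line_crossing`). Both parts follow by inclusion of events: the threshold of (ii) is a
supremum over directions, and in (i) super-Gaussianity makes `√q (ψ*)⁻¹(c/q)` non-increasing, so `q
= γ_min` dominates. -/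

lemma zero_mem_dom (hl : 0 < lmax) : (0 : ℝ) ∈ dom lmax := ⟨le_rfl, by simpa using hl⟩

lemma mem_dom_of_le {x y : ℝ} (hy : y ∈ dom lmax) (hx : 0 ≤ x) (hxy : x ≤ y) : x ∈ dom lmax :=
  ⟨hx, lt_of_le_of_lt (EReal.coe_le_coe_iff.2 hxy) hy.2⟩

lemma Icc_subset_dom {y : ℝ} (hy : y ∈ dom lmax) : Set.Icc 0 y ⊆ dom lmax :=
  fun _ hx => mem_dom_of_le hy hx.1 hx.2

lemma exists_pos_mem_dom (hl : 0 < lmax) : ∃ x ∈ dom lmax, 0 < x := by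
  obtain ⟨q, hq0, hq⟩ := EReal.lt_iff_exists_real_btwn.1 hl
  have hq0' : 0 < q := by exact_mod_cast hq0
  exact ⟨q, ⟨hq0'.le, hq⟩, hq0'⟩

/-- Past a point `x₀` with `ψ'(x₀) > u`, convexity keeps the objective below its value at `x₀`, so
the compact interval `[0, x₀]` suffices. -/
lemma IsCGFLike.exists_isMaxOn (hψ : IsCGFLike lmax ψ) (hψ' : DerivUnbounded lmax ψ) (u : ℝ) :
    ∃ x ∈ dom lmax, IsMaxOn (fun x => u * x - ψ x) (dom lmax) x := by
  have hcont : ContinuousOn ψ (dom lmax) := hψ.contDiffOn.continuousOn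
  obtain ⟨x₀, hx₀, hux₀⟩ : ∃ x₀ ∈ dom lmax, u < derivWithin ψ (dom lmax) x₀ := by
    by_contra! hcon
    exact hψ' ⟨u, by rintro _ ⟨x, hx, rfl⟩; exact hcon x hx⟩
  have hdiff : DifferentiableWithinAt ℝ ψ (dom lmax) x₀ :=
    (hψ.contDiffOn.differentiableOn (by norm_num)) x₀ hx₀
  have hslope : ∀ x ∈ dom lmax, x₀ < x → u * x - ψ x ≤ u * x₀ - ψ x₀ := by
    intro x hx hlt
    have := hψ.strictConvexOn.convexOn.le_slope_of_hasDerivWithinAt hx₀ hx hlt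
      hdiff.hasDerivWithinAt
    rw [slope_def_field, le_div_iff₀ (by linarith)] at this
    nlinarith
  obtain ⟨x, hx, hmax⟩ := (isCompact_Icc (a := (0 : ℝ)) (b := x₀)).exists_isMaxOn
    ⟨0, le_rfl, hx₀.1⟩ (f := fun x => u * x - ψ x)
    ((continuousOn_const.mul continuousOn_id).sub (hcont.mono (Icc_subset_dom hx₀)))
  refine ⟨x, Icc_subset_dom hx₀ hx, fun y hy => ?_⟩
  rcases le_or_gt y x₀ with h | h
  · exact hmax ⟨hy.1, h⟩
  · exact (hslope y hy h).trans (hmax ⟨hx₀.1, le_rfl⟩)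

lemma IsCGFLike.bddAbove (hψ : IsCGFLike lmax ψ) (hψ' : DerivUnbounded lmax ψ) (u : ℝ) :
    BddAbove ((fun x => u * x - ψ x) '' dom lmax) := by
  obtain ⟨x, _, hmax⟩ := hψ.exists_isMaxOn hψ' u
  exact ⟨_, by rintro _ ⟨y, hy, rfl⟩; exact hmax hy⟩

lemma IsCGFLike.le_conj (hψ : IsCGFLike lmax ψ) (hψ' : DerivUnbounded lmax ψ) (u : ℝ) {x : ℝ}
    (hx : x ∈ dom lmax) : u * x - ψ x ≤ conj lmax ψ u :=
  le_csSup (hψ.bddAbove hψ' u) ⟨x, hx, rfl⟩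

lemma IsCGFLike.conj_le (hψ : IsCGFLike lmax ψ) {u c : ℝ}
    (hc : ∀ x ∈ dom lmax, u * x - ψ x ≤ c) : conj lmax ψ u ≤ c :=
  csSup_le ⟨_, 0, zero_mem_dom hψ.lmax_pos, rfl⟩ (by rintro _ ⟨y, hy, rfl⟩; exact hc y hy)

lemma IsCGFLike.exists_eq_conj (hψ : IsCGFLike lmax ψ) (hψ' : DerivUnbounded lmax ψ) (u : ℝ) :
    ∃ x ∈ dom lmax, u * x - ψ x = conj lmax ψ u := by
  obtain ⟨x, hx, hmax⟩ := hψ.exists_isMaxOn hψ' u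
  exact ⟨x, hx, le_antisymm (hψ.le_conj hψ' u hx) (hψ.conj_le fun y hy => hmax hy)⟩

lemma IsCGFLike.conj_zero (hψ : IsCGFLike lmax ψ) (hψ' : DerivUnbounded lmax ψ) :
    conj lmax ψ 0 = 0 := by
  refine le_antisymm (hψ.conj_le fun x hx => ?_) ?_
  · have := hψ.nonneg x hx
    linarith
  · simpa [hψ.zero] using hψ.le_conj hψ' 0 (zero_mem_dom hψ.lmax_pos)

lemma IsCGFLike.conj_mono (hψ : IsCGFLike lmax ψ) (hψ' : DerivUnbounded lmax ψ) :
    Monotone (conj lmax ψ) := fun u v huv =>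
  hψ.conj_le fun x hx =>
    le_trans (by have := mul_le_mul_of_nonneg_right huv hx.1; linarith) (hψ.le_conj hψ' v hx)

lemma IsCGFLike.convexOn_conj (hψ : IsCGFLike lmax ψ) (hψ' : DerivUnbounded lmax ψ) :
    ConvexOn ℝ Set.univ (conj lmax ψ) := by
  refine ⟨convex_univ, fun u _ v _ a b ha hb hab => hψ.conj_le fun x hx => ?_⟩
  have h1 := mul_le_mul_of_nonneg_left (hψ.le_conj hψ' u hx) ha
  have h2 := mul_le_mul_of_nonneg_left (hψ.le_conj hψ' v hx) hb
  simp only [smul_eq_mul]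
  have : (a * u + b * v) * x - ψ x = a * (u * x - ψ x) + b * (v * x - ψ x) := by
    linear_combination (ψ x) * hab
  linarith

lemma IsCGFLike.continuous_conj (hψ : IsCGFLike lmax ψ) (hψ' : DerivUnbounded lmax ψ) :
    Continuous (conj lmax ψ) :=
  continuousOn_univ.1 ((hψ.convexOn_conj hψ').continuousOn isOpen_univ)

lemma IsCGFLike.exists_conj_eq (hψ : IsCGFLike lmax ψ) (hψ' : DerivUnbounded lmax ψ) {y : ℝ}
    (hy : 0 ≤ y) : ∃ u ∈ Set.Ici (0 : ℝ), conj lmax ψ u = y := by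
  obtain ⟨x, hx, hx0⟩ := exists_pos_mem_dom hψ.lmax_pos
  -- This slope makes the single point `x` contribute exactly `v * x - ψ x = y`, hence `ψ*(v) ≥ y`.
  set v := (y + ψ x) / x with hv
  have hv0 : 0 ≤ v := div_nonneg (add_nonneg hy (hψ.nonneg x hx)) hx0.le
  have hyv : y ≤ conj lmax ψ v := by
    have := hψ.le_conj hψ' v hx
    rw [hv, div_mul_cancel₀ _ hx0.ne'] at this
    linarith
  obtain ⟨u, hu, huy⟩ := intermediate_value_Icc hv0 (hψ.continuous_conj hψ').continuousOn
    ⟨by rw [hψ.conj_zero hψ']; exact hy, hyv⟩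
  exact ⟨u, hu.1, huy⟩

lemma IsCGFLike.conj_conjInv (hψ : IsCGFLike lmax ψ) (hψ' : DerivUnbounded lmax ψ) {y : ℝ}
    (hy : 0 ≤ y) : conj lmax ψ (conjInv lmax ψ y) = y :=
  Function.invFunOn_eq (hψ.exists_conj_eq hψ' hy)

lemma IsCGFLike.conjInv_nonneg (hψ : IsCGFLike lmax ψ) (hψ' : DerivUnbounded lmax ψ) {y : ℝ}
    (hy : 0 ≤ y) : 0 ≤ conjInv lmax ψ y :=
  Function.invFunOn_mem (hψ.exists_conj_eq hψ' hy)

lemma IsCGFLike.conjInv_mono (hψ : IsCGFLike lmax ψ) (hψ' : DerivUnbounded lmax ψ) {y z : ℝ}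
    (hy : 0 ≤ y) (hyz : y ≤ z) : conjInv lmax ψ y ≤ conjInv lmax ψ z := by
  rcases hyz.eq_or_lt with rfl | hlt
  · exact le_rfl
  · by_contra! hcon
    have := hψ.conj_mono hψ' hcon.le
    rw [hψ.conj_conjInv hψ' hy, hψ.conj_conjInv hψ' (hy.trans hyz)] at this
    linarith

/-- Convexity and `ψ*(0) = 0` give `ψ*(a) ≤ (a / w) ψ*(w)` with `a / w < 1`; positivity then makes
the inequality strict. -/
lemma IsCGFLike.conj_lt_conj (hψ : IsCGFLike lmax ψ) (hψ' : DerivUnbounded lmax ψ) {a w : ℝ}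
    (ha : 0 ≤ a) (hpos : 0 < conj lmax ψ a) (haw : a < w) : conj lmax ψ a < conj lmax ψ w := by
  have hw : 0 < w := ha.trans_lt haw
  have hle : a / w ≤ 1 := (div_le_one hw).2 haw.le
  have hconv := (hψ.convexOn_conj hψ').2 (Set.mem_univ (0 : ℝ)) (Set.mem_univ w)
    (sub_nonneg.2 hle) (div_nonneg ha hw.le) (sub_add_cancel 1 (a / w))
  simp only [smul_eq_mul, mul_zero, zero_add, hψ.conj_zero hψ', div_mul_cancel₀ a hw.ne'] at hconv
  have hlt : a / w < 1 := (div_lt_one hw).2 haw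
  have hmono := hψ.conj_mono hψ' haw.le
  nlinarith

lemma IsSuperGaussian.sq_mul_le (hsg : IsSuperGaussian lmax ψ) (h0 : ψ 0 = 0) {t x : ℝ}
    (ht : 1 ≤ t) (hx : x ∈ dom lmax) : t ^ 2 * ψ (x / t) ≤ ψ x := by
  have ht0 : 0 < t := by linarith
  rcases hx.1.eq_or_lt with rfl | hx0
  · simp [h0]
  · have hle : x / t ≤ x := div_le_self hx0.le ht
    have hpos : 0 < x / t := by positivity
    have := hsg ⟨mem_dom_of_le hx hpos.le hle, hpos.ne'⟩ ⟨hx, hx0.ne'⟩ hle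
    simp only at this
    rw [div_le_div_iff₀ (by positivity) (by positivity)] at this
    have h2 : ψ (x / t) * x ^ 2 = (t ^ 2 * ψ (x / t)) * (x / t) ^ 2 := by
      field_simp
    rw [h2] at this
    exact le_of_mul_le_mul_right this (by positivity)

/-- Since `ψ(x) ≥ t² ψ(x/t)`, each competitor `x` for `t * u` is at most `t²` times the competitor
`x / t` for `u`. -/
lemma IsCGFLike.conj_mul_le (hψ : IsCGFLike lmax ψ) (hψ' : DerivUnbounded lmax ψ)
    (hsg : IsSuperGaussian lmax ψ) {t : ℝ} (ht : 1 ≤ t) (u : ℝ) :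
    conj lmax ψ (t * u) ≤ t ^ 2 * conj lmax ψ u := by
  have ht0 : 0 < t := by linarith
  refine hψ.conj_le fun x hx => ?_
  have h1 := hψ.le_conj hψ' u (mem_dom_of_le hx (div_nonneg hx.1 ht0.le) (div_le_self hx.1 ht))
  have h2 := hsg.sq_mul_le hψ.zero ht hx
  have h3 := mul_le_mul_of_nonneg_left h1 (sq_nonneg t)
  have h4 : t ^ 2 * (u * (x / t) - ψ (x / t)) = t * u * x - t ^ 2 * ψ (x / t) := by
    field_simp
  linarith

/-- For super-Gaussian `ψ`, the map `q ↦ √q (ψ*)⁻¹(c / q)` is non-increasing. -/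
lemma IsCGFLike.sqrt_mul_conjInv_anti (hψ : IsCGFLike lmax ψ) (hψ' : DerivUnbounded lmax ψ)
    (hsg : IsSuperGaussian lmax ψ) {c p q : ℝ} (hc : 0 < c) (hp : 0 < p) (hpq : p ≤ q) :
    Real.sqrt q * conjInv lmax ψ (c / q) ≤ Real.sqrt p * conjInv lmax ψ (c / p) := by
  have hq : 0 < q := hp.trans_le hpq
  set a := conjInv lmax ψ (c / p)
  set b := conjInv lmax ψ (c / q)
  have ha : conj lmax ψ a = c / p := hψ.conj_conjInv hψ' (by positivity)
  have hb : conj lmax ψ b = c / q := hψ.conj_conjInv hψ' (by positivity)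
  have ha0 : 0 ≤ a := hψ.conjInv_nonneg hψ' (by positivity)
  set t := Real.sqrt (q / p)
  have ht : 1 ≤ t := Real.one_le_sqrt.2 ((one_le_div hp).2 hpq)
  have ht2 : t ^ 2 = q / p := Real.sq_sqrt (by positivity)
  have hsq : Real.sqrt q = Real.sqrt p * t := by
    rw [← Real.sqrt_mul hp.le, mul_div_cancel₀ _ hp.ne']
  rw [hsq, mul_assoc]
  refine mul_le_mul_of_nonneg_left ?_ (Real.sqrt_nonneg p)
  -- If `a < t b`, then `c/p = ψ*(a) < ψ*(t b) ≤ t² ψ*(b) = c/p`.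
  by_contra! hcon
  have h1 := hψ.conj_lt_conj hψ' ha0 (by rw [ha]; positivity) hcon
  have h2 := hψ.conj_mul_le hψ' hsg ht b
  rw [hb, ht2] at h2
  rw [ha] at h1
  have : q / p * (c / q) = c / p := by field_simp
  linarith

end Conj

/-! ### Ville's inequality -/

section Ville

variable {Ω : Type*} {mΩ : MeasurableSpace Ω} {μ : Measure Ω} {ℱ : Filtration ℕ mΩ}

/-- Optional stopping at the first time in `[0, n]` with `L ≥ c` (or at `n` if there is none),
followed by Markov's inequality. -/
lemma supermartingale_maximal_ineq [IsFiniteMeasure μ] {L : ℕ → Ω → ℝ}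
    (hL : Supermartingale L ℱ μ) (hnonneg : ∀ t, ∀ᵐ ω ∂μ, 0 ≤ L t ω) {c : ℝ} (hc : 0 < c) (n : ℕ) :
    μ {ω | ∃ t ≤ n, c ≤ L t ω} ≤ ENNReal.ofReal ((∫ ω, L 0 ω ∂μ) / c) := by
  set σ : Ω → ℕ := hittingBtwn L (Set.Ici c) 0 n
  have hσ : IsStoppingTime ℱ fun ω => (σ ω : WithTop ℕ) :=
    hL.stronglyAdapted.adapted.isStoppingTime_hittingBtwn measurableSet_Ici
  have hσn : ∀ ω, (σ ω : WithTop ℕ) ≤ n := fun ω =>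
    WithTop.coe_le_coe.2 (hittingBtwn_le (u := L) (s := Set.Ici c) (n := 0) (m := n) ω)
  have hopt : ∫ ω, -L 0 ω ∂μ ≤ ∫ ω, -L (σ ω) ω ∂μ :=
    hL.neg.expected_stoppedValue_mono (isStoppingTime_const ℱ 0) hσ
      (fun ω => WithTop.coe_le_coe.2 (Nat.zero_le _)) hσn
  rw [integral_neg, integral_neg, neg_le_neg_iff] at hopt
  have hint : Integrable (fun ω => L (σ ω) ω) μ := by
    have : Integrable (fun ω => -L (σ ω) ω) μ := hL.neg.integrable_stoppedValue hσ hσn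
    simpa using this.neg
  have hpos : 0 ≤ᵐ[μ] fun ω => L (σ ω) ω := by
    filter_upwards [ae_all_iff.2 hnonneg] with ω hω using hω _
  have hmarkov := mul_meas_ge_le_integral_of_nonneg hpos hint c
  have hsub : {ω | ∃ t ≤ n, c ≤ L t ω} ⊆ {ω | c ≤ L (σ ω) ω} := by
    rintro ω ⟨t, ht, hct⟩
    exact stoppedValue_hittingBtwn_mem (u := L) (s := Set.Ici c) (n := 0) (m := n)
      ⟨t, ⟨Nat.zero_le _, ht⟩, hct⟩
  refine (measure_mono hsub).trans ?_
  rw [← ofReal_measureReal]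
  refine ENNReal.ofReal_le_ofReal ?_
  rw [le_div_iff₀ hc, mul_comm]
  exact hmarkov.trans hopt

/-- **Ville's inequality** for nonnegative supermartingales. -/
lemma ville_ineq [IsFiniteMeasure μ] {L : ℕ → Ω → ℝ}
    (hL : Supermartingale L ℱ μ) (hnonneg : ∀ t, ∀ᵐ ω ∂μ, 0 ≤ L t ω) {c : ℝ} (hc : 0 < c) :
    μ {ω | ∃ t, c ≤ L t ω} ≤ ENNReal.ofReal ((∫ ω, L 0 ω ∂μ) / c) := by
  have hU : {ω | ∃ t, c ≤ L t ω} = ⋃ n : ℕ, {ω | ∃ t ≤ n, c ≤ L t ω} := by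
    ext ω
    simp only [Set.mem_ofPred_eq, Set.mem_iUnion]
    exact ⟨fun ⟨t, ht⟩ => ⟨t, t, le_rfl, ht⟩, fun ⟨_, t, _, ht⟩ => ⟨t, ht⟩⟩
  have hmono : Monotone fun n : ℕ => {ω | ∃ t ≤ n, c ≤ L t ω} :=
    fun m n hmn ω ⟨t, ht, h⟩ => ⟨t, ht.trans hmn, h⟩
  rw [hU, hmono.measure_iUnion]
  exact iSup_le fun n => supermartingale_maximal_ineq hL hnonneg hc n

lemma IsSubPsiScalar.measure_line_crossing_le [IsFiniteMeasure μ] {lmax : EReal} {ψ : ℝ → ℝ}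
    {S V : ℕ → Ω → ℝ} (hSV : IsSubPsiScalar μ ℱ lmax ψ S V) {x : ℝ} (hx : x ∈ dom lmax) (y : ℝ) :
    μ {ω | ∃ t, y ≤ x * S t ω - ψ x * V t ω} ≤ ENNReal.ofReal (Real.exp (-y)) := by
  obtain ⟨L, hL, hnonneg, hinit, hdom⟩ := hSV.dominated x hx
  calc μ {ω | ∃ t, y ≤ x * S t ω - ψ x * V t ω}
      ≤ μ {ω | ∃ t, Real.exp y ≤ L t ω} := by
        refine measure_mono_ae ?_
        filter_upwards [ae_all_iff.2 hdom] with ω hω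
        rintro ⟨t, ht⟩
        exact ⟨t, (Real.exp_le_exp.2 ht).trans (hω t)⟩
    _ ≤ ENNReal.ofReal ((∫ ω, L 0 ω ∂μ) / Real.exp y) := ville_ineq hL hnonneg (Real.exp_pos y)
    _ ≤ ENNReal.ofReal (Real.exp (-y)) := by
        refine ENNReal.ofReal_le_ofReal ?_
        rw [Real.exp_neg, div_eq_mul_inv]
        exact mul_le_of_le_one_left (by positivity) hinit

end Ville

/-! ### Spectral estimates -/

section Spectral

open scoped MatrixOrder

variable {d : ℕ}

lemma quadForm_nonneg {A : Matrix (Fin d) (Fin d) ℝ} (hA : A.PosSemidef)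
    (ν : EuclideanSpace ℝ (Fin d)) : 0 ≤ quadForm A ν := by
  have := (Matrix.isPositive_toEuclideanLin_iff.2 hA).re_inner_nonneg_right ν
  simpa [quadForm] using this

lemma quadForm_mono {A B : Matrix (Fin d) (Fin d) ℝ} (hAB : A ≤ B)
    (ν : EuclideanSpace ℝ (Fin d)) : quadForm A ν ≤ quadForm B ν := by
  have := quadForm_nonneg (Matrix.le_iff.1 hAB) ν
  rw [quadForm, map_sub, LinearMap.sub_apply, inner_sub_right] at this
  exact sub_nonneg.1 this

lemma toEuclideanLin_mul_apply (A B : Matrix (Fin d) (Fin d) ℝ) (x : EuclideanSpace ℝ (Fin d)) :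
    Matrix.toEuclideanLin (A * B) x = Matrix.toEuclideanLin A (Matrix.toEuclideanLin B x) := by
  ext i
  simp [Matrix.toLpLin_apply]

lemma toEuclideanLin_one_apply (x : EuclideanSpace ℝ (Fin d)) :
    Matrix.toEuclideanLin (1 : Matrix (Fin d) (Fin d) ℝ) x = x := by
  ext i
  simp

lemma quadForm_algebraMap (r : ℝ) (ν : EuclideanSpace ℝ (Fin d)) :
    quadForm (algebraMap ℝ (Matrix (Fin d) (Fin d) ℝ) r) ν = r * ‖ν‖ ^ 2 := by
  rw [quadForm, Algebra.algebraMap_eq_smul_one, map_smul, LinearMap.smul_apply,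
    toEuclideanLin_one_apply, inner_smul_right, real_inner_self_eq_norm_sq]

lemma isSelfAdjoint_clip (V : Matrix (Fin d) (Fin d) ℝ) (ρ : ℝ) : IsSelfAdjoint (clip V ρ) :=
  cfc_predicate _ V

lemma spectrum_finite_of_isSelfAdjoint {A : Matrix (Fin d) (Fin d) ℝ} (hA : IsSelfAdjoint A) :
    (spectrum ℝ A).Finite := by
  have hA' : A.IsHermitian := hA
  rw [hA'.spectrum_real_eq_range_eigenvalues]
  exact Set.finite_range _

lemma spectrum_nonempty_of_isSelfAdjoint (hd : 1 ≤ d) {A : Matrix (Fin d) (Fin d) ℝ}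
    (hA : IsSelfAdjoint A) : (spectrum ℝ A).Nonempty := by
  have hA' : A.IsHermitian := hA
  have : Nonempty (Fin d) := ⟨⟨0, hd⟩⟩
  rw [hA'.spectrum_real_eq_range_eigenvalues]
  exact Set.range_nonempty _

lemma quadForm_le_gammaMax {A : Matrix (Fin d) (Fin d) ℝ} (hA : IsSelfAdjoint A)
    (ν : EuclideanSpace ℝ (Fin d)) : quadForm A ν ≤ gammaMax A * ‖ν‖ ^ 2 := by
  rw [← quadForm_algebraMap]
  exact quadForm_mono (le_algebraMap_of_spectrum_le fun x hx =>
    le_csSup (spectrum_finite_of_isSelfAdjoint hA).bddAbove hx) ν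

lemma gammaMin_le_quadForm {A : Matrix (Fin d) (Fin d) ℝ} (hA : IsSelfAdjoint A)
    (ν : EuclideanSpace ℝ (Fin d)) : gammaMin A * ‖ν‖ ^ 2 ≤ quadForm A ν := by
  rw [← quadForm_algebraMap]
  exact quadForm_mono (algebraMap_le_of_le_spectrum fun x hx =>
    csInf_le (spectrum_finite_of_isSelfAdjoint hA).bddBelow hx) ν

lemma le_of_mem_spectrum_clip {V : Matrix (Fin d) (Fin d) ℝ} (hV : V.PosSemidef) {ρ x : ℝ}
    (hx : x ∈ spectrum ℝ (clip V ρ)) : ρ ≤ x := by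
  have hsa : IsSelfAdjoint V := hV.1
  rw [clip, cfc_map_spectrum (fun x : ℝ => max x ρ) V hsa (by fun_prop)] at hx
  obtain ⟨y, _, rfl⟩ := hx
  exact le_max_right _ _

lemma le_gammaMin_clip (hd : 1 ≤ d) {V : Matrix (Fin d) (Fin d) ℝ} (hV : V.PosSemidef) (ρ : ℝ) :
    ρ ≤ gammaMin (clip V ρ) :=
  le_csInf (spectrum_nonempty_of_isSelfAdjoint hd (isSelfAdjoint_clip V ρ)) fun _ hx =>
    le_of_mem_spectrum_clip hV hx

lemma gammaMin_le_gammaMax (hd : 1 ≤ d) {A : Matrix (Fin d) (Fin d) ℝ} (hA : IsSelfAdjoint A) :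
    gammaMin A ≤ gammaMax A :=
  csInf_le_csSup (spectrum_nonempty_of_isSelfAdjoint hd hA)
    (spectrum_finite_of_isSelfAdjoint hA).bddBelow (spectrum_finite_of_isSelfAdjoint hA).bddAbove

lemma quadForm_le_quadForm_clip {V : Matrix (Fin d) (Fin d) ℝ} (hV : V.PosSemidef) (ρ : ℝ)
    (ν : EuclideanSpace ℝ (Fin d)) : quadForm V ν ≤ quadForm (clip V ρ) ν := by
  have hsa : IsSelfAdjoint V := hV.1
  refine quadForm_mono ?_ ν
  conv_lhs => rw [← cfc_id ℝ V hsa]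
  exact cfc_mono (fun x _ => le_max_left _ _) (by fun_prop) (by fun_prop)

/-- A square root of a positive definite matrix whose inverse is `invSqrt`. -/
lemma exists_sqrt {W : Matrix (Fin d) (Fin d) ℝ} (hW : IsSelfAdjoint W)
    (hpos : ∀ x ∈ spectrum ℝ W, 0 < x) :
    ∃ B : Matrix (Fin d) (Fin d) ℝ, IsSelfAdjoint B ∧ B * B = W ∧ B * invSqrt W = 1 := by
  have hfin := spectrum_finite_of_isSelfAdjoint hW
  refine ⟨cfc Real.sqrt W, cfc_predicate _ W, ?_, ?_⟩
  · rw [← cfc_mul Real.sqrt Real.sqrt W (hfin.continuousOn _) (hfin.continuousOn _)]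
    conv_rhs => rw [← cfc_id ℝ W hW]
    exact cfc_congr fun x hx => Real.mul_self_sqrt (hpos x hx).le
  · rw [invSqrt, ← cfc_mul Real.sqrt (fun x => (Real.sqrt x)⁻¹) W (hfin.continuousOn _)
      (hfin.continuousOn _), ← cfc_one ℝ W hW]
    exact cfc_congr fun x hx => mul_inv_cancel₀ (Real.sqrt_pos.2 (hpos x hx)).ne'

lemma inner_toEuclideanLin_of_isSelfAdjoint {B : Matrix (Fin d) (Fin d) ℝ} (hB : IsSelfAdjoint B)
    (x y : EuclideanSpace ℝ (Fin d)) :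
    inner ℝ (Matrix.toEuclideanLin B x) y = inner ℝ x (Matrix.toEuclideanLin B y) :=
  Matrix.isSymmetric_toEuclideanLin_iff.2 hB x y

/-- Some direction realizes the self-normalized norm, and every direction close to it nearly
does. -/
lemma exists_direction (hd : 1 ≤ d) {V : Matrix (Fin d) (Fin d) ℝ} (hV : V.PosSemidef) {ρ : ℝ}
    (hρ : 0 < ρ) (s : EuclideanSpace ℝ (Fin d)) :
    ∃ ν ∈ Metric.sphere (0 : EuclideanSpace ℝ (Fin d)) 1,
      ∀ ν' ∈ Metric.sphere (0 : EuclideanSpace ℝ (Fin d)) 1, ∀ ε ∈ Set.Ioo (0 : ℝ) 1,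
        gammaMax (clip V ρ) * ‖ν - ν'‖ ^ 2 ≤ ε ^ 2 * gammaMin (clip V ρ) →
        (1 - ε) * (Real.sqrt (quadForm (clip V ρ) ν') * selfNorm ρ V s) ≤ inner ℝ ν' s := by
  set W := clip V ρ with hWdef
  have hW : IsSelfAdjoint W := isSelfAdjoint_clip V ρ
  have hmin : ρ ≤ gammaMin W := le_gammaMin_clip hd hV ρ
  obtain ⟨B, hB, hBB, hBA⟩ := exists_sqrt hW fun x hx => hρ.trans_le (le_of_mem_spectrum_clip hV hx)
  have hAB : invSqrt W * B = 1 := mul_eq_one_comm.1 hBA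
  have hq : ∀ ν, quadForm W ν = ‖Matrix.toEuclideanLin B ν‖ ^ 2 := fun ν => by
    rw [← real_inner_self_eq_norm_sq, inner_toEuclideanLin_of_isSelfAdjoint hB,
      ← toEuclideanLin_mul_apply, hBB, quadForm]
  set z := Matrix.toEuclideanLin (invSqrt W) s with hz
  have hs : Matrix.toEuclideanLin B z = s := by
    rw [hz, ← toEuclideanLin_mul_apply, hBA, toEuclideanLin_one_apply]
  have hnorm : selfNorm ρ V s = ‖z‖ := rfl
  rcases eq_or_ne z 0 with hz0 | hz0
  · refine ⟨EuclideanSpace.single ⟨0, hd⟩ 1, by simp, fun ν' _ ε _ _ => ?_⟩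
    rw [hnorm, ← hs, hz0]
    simp
  -- Here `w = W⁻¹s`, and `B = W^{1/2}` sends it to `z`; along `w`, Cauchy–Schwarz for `⟨ν, s⟩ =
  -- ⟨Bν, z⟩` is an equality.
  · set w := Matrix.toEuclideanLin (invSqrt W) z with hw
    have hBw : Matrix.toEuclideanLin B w = z := by
      rw [hw, ← toEuclideanLin_mul_apply, hBA, toEuclideanLin_one_apply]
    have hw0 : w ≠ 0 := fun h => hz0 (by rw [← hBw, h, map_zero])
    have hwn : 0 < ‖w‖ := norm_pos_iff.2 hw0
    refine ⟨‖w‖⁻¹ • w, by simp [norm_smul, hwn.ne'], fun ν' hν' ε hε hclose => ?_⟩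
    set ν := ‖w‖⁻¹ • w with hν
    have hν1 : ‖ν‖ = 1 := by simp [hν, norm_smul, hwn.ne']
    have hν'1 : ‖ν'‖ = 1 := by simpa using hν'
    set x := Matrix.toEuclideanLin B ν' with hx
    set y := Matrix.toEuclideanLin B ν with hy
    have hyz : y = ‖w‖⁻¹ • z := by rw [hy, hν, map_smul, hBw]
    have hzy : z = ‖w‖ • y := by rw [hyz, smul_smul, mul_inv_cancel₀ hwn.ne', one_smul]
    have hinner : inner ℝ ν' s = ‖w‖ * inner ℝ x y := by
      rw [← hs, ← inner_toEuclideanLin_of_isSelfAdjoint hB, ← hx, hzy, inner_smul_right]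
    have hx2 : gammaMin W ≤ ‖x‖ ^ 2 := by
      simpa [hν'1, hq] using gammaMin_le_quadForm hW ν'
    have hy2 : gammaMin W ≤ ‖y‖ ^ 2 := by
      simpa [hν1, hq] using gammaMin_le_quadForm hW ν
    have hyx : ‖y - x‖ ^ 2 ≤ ε ^ 2 * gammaMin W := by
      refine le_trans ?_ hclose
      have := quadForm_le_gammaMax hW (ν - ν')
      rwa [hq, map_sub] at this
    have hprod : gammaMin W ≤ ‖x‖ * ‖y‖ := by
      refine le_of_sq_le_sq ?_ (by positivity)
      rw [mul_pow, sq]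
      exact mul_le_mul hx2 hy2 (hρ.le.trans hmin) (by positivity)
    -- Polarization: `2⟨x, y⟩ = ‖x‖² + ‖y‖² - ‖y - x‖² ≥ 2‖x‖‖y‖ - ε² γ_min`, and `γ_min ≤ ‖x‖‖y‖`.
    have hkey : (1 - ε) * (‖x‖ * ‖y‖) ≤ inner ℝ x y := by
      have h1 := norm_sub_sq_real y x
      rw [real_inner_comm] at h1
      have h2 : ε ^ 2 * gammaMin W ≤ ε * (‖x‖ * ‖y‖) :=
        mul_le_mul (by nlinarith [hε.1, hε.2]) hprod (hρ.le.trans hmin) hε.1.le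
      have h3 : 0 ≤ ε * (‖x‖ * ‖y‖) := mul_nonneg hε.1.le (by positivity)
      nlinarith [sq_nonneg (‖x‖ - ‖y‖)]
    have hsqrt : Real.sqrt (quadForm W ν') = ‖x‖ := by
      rw [hq, Real.sqrt_sq (norm_nonneg _)]
    rw [hsqrt, hnorm, hinner, hzy, norm_smul, norm_norm]
    calc (1 - ε) * (‖x‖ * (‖w‖ * ‖y‖)) = ‖w‖ * ((1 - ε) * (‖x‖ * ‖y‖)) := by ring
      _ ≤ ‖w‖ * inner ℝ x y := mul_le_mul_of_nonneg_left hkey hwn.le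

end Spectral

/-! ### Covers of the sphere -/

section Cover

variable {d : ℕ}

/-- Finiteness matters because `toNat` sends `⊤` to `0`, which would falsify the monotonicity of
`sphereCov`. -/
lemma coveringNumber_sphere_ne_top {r : ℝ} (hr : 0 < r) :
    Metric.coveringNumber r.toNNReal (Metric.sphere (0 : EuclideanSpace ℝ (Fin d)) 1) ≠ ⊤ := by
  obtain ⟨N, hN, hfin, hcov⟩ := Metric.exists_finite_isCover_of_isCompact
    (Real.toNNReal_pos.2 hr).ne' (isCompact_sphere (0 : EuclideanSpace ℝ (Fin d)) 1)
  exact ne_top_of_le_ne_top (Set.encard_ne_top_iff.2 hfin) (hcov.coveringNumber_le_encard hN)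

lemma sphereCov_anti {r r' : ℝ} (hr : 0 < r) (hrr' : r ≤ r') : sphereCov d r' ≤ sphereCov d r :=
  ENat.toNat_le_toNat (Metric.coveringNumber_anti (Real.toNNReal_le_toNNReal hrr'))
    (coveringNumber_sphere_ne_top hr)

lemma exists_sphere_cover {r : ℝ} (hr : 0 < r) :
    ∃ K : Finset (EuclideanSpace ℝ (Fin d)),
      (∀ ν ∈ K, ν ∈ Metric.sphere (0 : EuclideanSpace ℝ (Fin d)) 1) ∧ K.card = sphereCov d r ∧
      ∀ ν ∈ Metric.sphere (0 : EuclideanSpace ℝ (Fin d)) 1, ∃ ν' ∈ K, ‖ν - ν'‖ ≤ r := by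
  obtain ⟨C, hC, hfin, hcov, hcard⟩ :=
    Metric.exists_set_encard_eq_coveringNumber (coveringNumber_sphere_ne_top (d := d) hr)
  refine ⟨hfin.toFinset, fun ν hν => hC (hfin.mem_toFinset.1 hν), ?_, fun ν hν => ?_⟩
  · rw [sphereCov, ← hcard, hfin.encard_eq_coe_toFinset_card, ENat.toNat_natCast]
  · obtain ⟨ν', hν', hdist⟩ : ∃ ν' ∈ C, dist ν ν' ≤ r := by
      simpa [Real.coe_toNNReal r hr.le] using Metric.isCover_iff_subset_iUnion_closedBall.1 hcov hν
    exact ⟨ν', hfin.mem_toFinset.2 hν', by rwa [← dist_eq_norm]⟩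

lemma sphereCov_pos (hd : 1 ≤ d) {r : ℝ} (hr : 0 < r) : 0 < sphereCov d r := by
  obtain ⟨K, -, hcard, hcov⟩ := exists_sphere_cover (d := d) hr
  obtain ⟨ν, hν, -⟩ := hcov (EuclideanSpace.single ⟨0, hd⟩ 1) (by simp)
  exact hcard ▸ Finset.card_pos.2 ⟨ν, hν⟩

end Cover

/-! ### The union bound -/

section Union

/-- In `ℝ≥0∞` the inverse of `0` is `∞`, so the summability condition excludes `h k ≤ 0`. -/
lemma one_le_of_tsum_inv_le {h : ℝ → ℝ} (hsum : ∑' k : ℕ, (ENNReal.ofReal (h k))⁻¹ ≤ 1) (k : ℕ) :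
    1 ≤ h k := by
  have := (ENNReal.le_tsum k).trans hsum
  rwa [ENNReal.inv_le_one, ENNReal.one_le_ofReal] at this

/-- The level crossed by the lines associated with condition numbers in `[β ^ (2 j), β ^ (2 j + 2))`
and variances in `[ρ α ^ k, ρ α ^ (k + 1))`. -/
noncomputable def cellLevel (d : ℕ) (β ε δ : ℝ) (h : ℝ → ℝ) (j k : ℕ) : ℝ :=
  Real.log (h k) + Real.log (1 / δ * (1 / (1 - β⁻¹)))
    + Real.log (β ^ (j + 1) * sphereCov d (ε / β ^ (j + 1)))

variable {d : ℕ} {α β ρ ε δ : ℝ} {h : ℝ → ℝ}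

lemma one_lt_confidence (hβ : 1 < β) (hδ : δ ∈ Set.Ioo (0 : ℝ) 1) :
    1 < 1 / δ * (1 / (1 - β⁻¹)) := by
  have hβ0 : 0 < β⁻¹ := by positivity
  have hβ1 : β⁻¹ < 1 := inv_lt_one_of_one_lt₀ hβ
  have h1 : 1 < 1 / δ := by rw [lt_div_iff₀ hδ.1]; linarith [hδ.2]
  have h2 : 1 < 1 / (1 - β⁻¹) := by rw [lt_div_iff₀ (by linarith)]; linarith
  nlinarith

lemma one_le_mul_sphereCov (hd : 1 ≤ d) {b r : ℝ} (hb : 1 ≤ b) (hr : 0 < r) :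
    1 ≤ b * (sphereCov d r : ℝ) := by
  have : (1 : ℝ) ≤ sphereCov d r := by exact_mod_cast sphereCov_pos hd hr
  nlinarith

lemma cellLevel_pos (hd : 1 ≤ d) (hβ : 1 < β) (hε : 0 < ε) (hδ : δ ∈ Set.Ioo (0 : ℝ) 1)
    (hsum : ∑' k : ℕ, (ENNReal.ofReal (h k))⁻¹ ≤ 1) (j k : ℕ) :
    0 < cellLevel d β ε δ h j k := by
  have hb : 1 ≤ β ^ (j + 1) := one_le_pow₀ hβ.le
  have h1 := Real.log_nonneg (one_le_of_tsum_inv_le hsum k)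
  have h2 := Real.log_pos (one_lt_confidence hβ hδ)
  have h3 := Real.log_nonneg (one_le_mul_sphereCov hd hb (r := ε / β ^ (j + 1)) (by positivity))
  rw [cellLevel]
  linarith

lemma exp_neg_cellLevel (hd : 1 ≤ d) (hβ : 1 < β) (hε : 0 < ε) (hδ : δ ∈ Set.Ioo (0 : ℝ) 1)
    (hsum : ∑' k : ℕ, (ENNReal.ofReal (h k))⁻¹ ≤ 1) (j k : ℕ) :
    ENNReal.ofReal (Real.exp (-cellLevel d β ε δ h j k)) =
      ENNReal.ofReal (δ * (1 - β⁻¹) * (β ^ (j + 1))⁻¹ * (sphereCov d (ε / β ^ (j + 1)) : ℝ)⁻¹)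
        * (ENNReal.ofReal (h k))⁻¹ := by
  have hβ1 : β⁻¹ < 1 := inv_lt_one_of_one_lt₀ hβ
  have hβ2 : 0 < 1 - β⁻¹ := by linarith
  have hδ0 := hδ.1
  have hh : 0 < h k := by linarith [one_le_of_tsum_inv_le hsum k]
  have hN : (0 : ℝ) < sphereCov d (ε / β ^ (j + 1)) := by
    exact_mod_cast sphereCov_pos hd (by positivity)
  have hb : 0 < β ^ (j + 1) := by positivity
  rw [← ENNReal.ofReal_inv_of_pos hh, ← ENNReal.ofReal_mul (by positivity), cellLevel,
    Real.exp_neg, Real.exp_add, Real.exp_add, Real.exp_log hh,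
    Real.exp_log (by linarith [one_lt_confidence hβ hδ]), Real.exp_log (by positivity)]
  congr 1
  field_simp

lemma tsum_exp_neg_cellLevel_le (hd : 1 ≤ d) (hβ : 1 < β) (hε : 0 < ε)
    (hδ : δ ∈ Set.Ioo (0 : ℝ) 1) (hsum : ∑' k : ℕ, (ENNReal.ofReal (h k))⁻¹ ≤ 1) :
    ∑' j : ℕ, (sphereCov d (ε / β ^ (j + 1)) : ℝ≥0∞) *
      ∑' k : ℕ, ENNReal.ofReal (Real.exp (-cellLevel d β ε δ h j k)) ≤ ENNReal.ofReal δ := by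
  have hβ0 : 0 < β⁻¹ := by positivity
  have hβ1 : β⁻¹ < 1 := inv_lt_one_of_one_lt₀ hβ
  have hβ2 : 0 < 1 - β⁻¹ := by linarith
  have hδ0 := hδ.1
  calc _ ≤ ∑' j : ℕ, ENNReal.ofReal (δ * (1 - β⁻¹) * β⁻¹ ^ j) := by
        refine ENNReal.tsum_le_tsum fun j => ?_
        have hN : (0 : ℝ) < sphereCov d (ε / β ^ (j + 1)) := by
          exact_mod_cast sphereCov_pos hd (by positivity)
        simp_rw [exp_neg_cellLevel hd hβ hε hδ hsum]
        rw [ENNReal.tsum_mul_left, ← ENNReal.ofReal_natCast, ← mul_assoc,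
          ← ENNReal.ofReal_mul hN.le]
        refine (mul_le_of_le_one_right' hsum).trans (ENNReal.ofReal_le_ofReal ?_)
        calc _ = δ * (1 - β⁻¹) * (β ^ (j + 1))⁻¹ := by field_simp
          -- One factor `β⁻¹` is given away, so that `1 - β⁻¹` exactly normalizes the geometric
          -- series.
          _ ≤ δ * (1 - β⁻¹) * β⁻¹ ^ j := by
            rw [← inv_pow]
            exact mul_le_mul_of_nonneg_left (pow_le_pow_of_le_one hβ0.le hβ1.le (Nat.le_succ j))
              (by positivity)
    _ = ENNReal.ofReal δ := by
        have hs := (hasSum_geometric_of_lt_one hβ0.le hβ1).mul_left (δ * (1 - β⁻¹))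
        rw [← ENNReal.ofReal_tsum_of_nonneg (fun j => by positivity) hs.summable, hs.tsum_eq,
          mul_assoc, mul_inv_cancel₀ hβ2.ne', mul_one]

end Union

/-! ### The self-normalized bound -/

section Main

variable {d : ℕ} {lmax : EReal} {ψ : ℝ → ℝ} {α β ρ ε δ : ℝ} {h : ℝ → ℝ}

lemma one_le_condNum (hd : 1 ≤ d) {V : Matrix (Fin d) (Fin d) ℝ} (hV : V.PosSemidef)
    (hρ : 0 < ρ) : 1 ≤ condNum (clip V ρ) := by
  have hmin := hρ.trans_le (le_gammaMin_clip hd hV ρ)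
  rw [condNum, one_le_div hmin]
  exact gammaMin_le_gammaMax hd (isSelfAdjoint_clip V ρ)

/-- Each term grows when the grid values are replaced by the actual ones. Rounding `√κ` up to
`β^(j+1)` costs at most the factor `β` present in `Lfun`, and a smaller radius needs a larger net.
-/
lemma cellLevel_le_Lfun (hd : 1 ≤ d) (hα : 1 < α) (hβ : 1 < β) (hε : 0 < ε)
    (hmono : MonotoneOn h (Set.Ici 0)) (hsum : ∑' k : ℕ, (ENNReal.ofReal (h k))⁻¹ ≤ 1)
    {V : Matrix (Fin d) (Fin d) ℝ} {j k : ℕ}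
    (hj : β ^ j ≤ Real.sqrt (condNum (clip V ρ))) (hk : α ^ k ≤ gammaMax (clip V ρ) / ρ) :
    cellLevel d β ε δ h j k ≤ Lfun α β ρ ε δ h V := by
  have hβ0 : 0 < β := by linarith
  have hkl : (k : ℝ) ≤ Real.logb α (gammaMax (clip V ρ) / ρ) := by
    rw [Real.le_logb_iff_rpow_le hα (lt_of_lt_of_le (by positivity) hk), Real.rpow_natCast]
    exact hk
  have h1 : Real.log (h k) ≤ Real.log (h (Real.logb α (gammaMax (clip V ρ) / ρ))) :=
    Real.log_le_log (by linarith [one_le_of_tsum_inv_le hsum k])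
      (hmono (Set.mem_Ici.2 k.cast_nonneg) (Set.mem_Ici.2 (k.cast_nonneg.trans hkl)) hkl)
  have hb : β ^ (j + 1) ≤ β * Real.sqrt (condNum (clip V ρ)) := by
    rw [pow_succ']
    exact mul_le_mul_of_nonneg_left hj hβ0.le
  have hb0 : 0 < β ^ (j + 1) := by positivity
  have hN : (0 : ℝ) < sphereCov d (ε / β ^ (j + 1)) := by
    exact_mod_cast sphereCov_pos hd (by positivity)
  have hcov : (sphereCov d (ε / β ^ (j + 1)) : ℝ)
      ≤ sphereCov d (ε / (β * Real.sqrt (condNum (clip V ρ)))) := by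
    exact_mod_cast sphereCov_anti (div_pos hε (hb0.trans_le hb))
      (div_le_div_of_nonneg_left hε.le hb0 hb)
  have h3 : Real.log (β ^ (j + 1) * sphereCov d (ε / β ^ (j + 1))) ≤
      Real.log (β * Real.sqrt (condNum (clip V ρ))
        * sphereCov d (ε / (β * Real.sqrt (condNum (clip V ρ))))) :=
    Real.log_le_log (by positivity) (mul_le_mul hb hcov hN.le (hb0.le.trans hb))
  rw [cellLevel, Lfun]
  linarith

lemma Lfun_pos (hd : 1 ≤ d) (hα : 1 < α) (hβ : 1 < β) (hρ : 0 < ρ) (hε : 0 < ε)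
    (hδ : δ ∈ Set.Ioo (0 : ℝ) 1) (hmono : MonotoneOn h (Set.Ici 0))
    (hsum : ∑' k : ℕ, (ENNReal.ofReal (h k))⁻¹ ≤ 1)
    {V : Matrix (Fin d) (Fin d) ℝ} (hV : V.PosSemidef) : 0 < Lfun α β ρ ε δ h V := by
  refine (cellLevel_pos hd hβ hε hδ hsum 0 0).trans_le
    (cellLevel_le_Lfun hd hα hβ hε hmono hsum ?_ ?_)
  · rw [pow_zero]
    exact Real.one_le_sqrt.2 (one_le_condNum hd hV hρ)
  · rw [pow_zero, one_le_div hρ]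
    exact (le_gammaMin_clip hd hV ρ).trans (gammaMin_le_gammaMax hd (isSelfAdjoint_clip V ρ))

/-- The deterministic core, for a single value of `(s, V)`: the grid cell and net point depend on
that value, but the lines do not. -/
lemma exists_line_crossing (hd : 1 ≤ d) (hψ : IsCGFLike lmax ψ) (hψ' : DerivUnbounded lmax ψ)
    (hα : 1 < α) (hβ : 1 < β) (hρ : 0 < ρ) (hε : ε ∈ Set.Ioo (0 : ℝ) 1)
    (hδ : δ ∈ Set.Ioo (0 : ℝ) 1) (hmono : MonotoneOn h (Set.Ici 0))
    (hsum : ∑' k : ℕ, (ENNReal.ofReal (h k))⁻¹ ≤ 1)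
    {K : ℕ → Finset (EuclideanSpace ℝ (Fin d))}
    (hK : ∀ j, ∀ ν ∈ K j, ν ∈ Metric.sphere (0 : EuclideanSpace ℝ (Fin d)) 1)
    (hKcov : ∀ j, ∀ ν ∈ Metric.sphere (0 : EuclideanSpace ℝ (Fin d)) 1,
      ∃ ν' ∈ K j, ‖ν - ν'‖ ≤ ε / β ^ (j + 1))
    {x : ℕ → ℕ → ℝ} (hx : ∀ j k, x j k ∈ dom lmax)
    (hxconj : ∀ j k, conjInv lmax ψ (cellLevel d β ε δ h j k / (ρ * α ^ k)) * x j k - ψ (x j k)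
      = cellLevel d β ε δ h j k / (ρ * α ^ k))
    {V : Matrix (Fin d) (Fin d) ℝ} (hV : V.PosSemidef) {s : EuclideanSpace ℝ (Fin d)}
    (hs : ∀ ν ∈ Metric.sphere (0 : EuclideanSpace ℝ (Fin d)) 1,
      Real.sqrt (quadForm (clip V ρ) ν) / (1 - ε)
        * conjInv lmax ψ (α / quadForm (clip V ρ) ν * Lfun α β ρ ε δ h V) ≤ selfNorm ρ V s) :
    ∃ j, ∃ ν ∈ K j, ∃ k, cellLevel d β ε δ h j k
      ≤ x j k * inner ℝ ν s - ψ (x j k) * quadForm V ν := by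
  have hW : IsSelfAdjoint (clip V ρ) := isSelfAdjoint_clip V ρ
  have hβ0 : 0 < β := by linarith
  have hα0 : 0 < α := by linarith
  have hmin : ρ ≤ gammaMin (clip V ρ) := le_gammaMin_clip hd hV ρ
  have hmin0 : 0 < gammaMin (clip V ρ) := hρ.trans_le hmin
  -- As `√κ < β^(j+1)`, the mesh `ε / β^(j+1)` of the `j`-th net is finer than `ε / √κ`.
  obtain ⟨j, hj1, hj2⟩ := exists_nat_pow_near
    (Real.one_le_sqrt.2 (one_le_condNum hd hV hρ)) hβ
  obtain ⟨ν₀, hν₀, hdir⟩ := exists_direction hd hV hρ s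
  obtain ⟨ν, hνK, hν⟩ := hKcov j ν₀ hν₀
  have hν1 := hK j ν hνK
  have hνn : ‖ν‖ = 1 := by simpa using hν1
  have hclose : gammaMax (clip V ρ) * ‖ν₀ - ν‖ ^ 2 ≤ ε ^ 2 * gammaMin (clip V ρ) := by
    have hb : 0 < β ^ (j + 1) := by positivity
    have h1 : ‖ν₀ - ν‖ * β ^ (j + 1) ≤ ε := (le_div_iff₀ hb).1 hν
    have h2 : condNum (clip V ρ) ≤ (β ^ (j + 1)) ^ 2 := (Real.sqrt_le_left hb.le).1 hj2.le
    rw [condNum, div_le_iff₀ hmin0] at h2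
    have h3 : (‖ν₀ - ν‖ * β ^ (j + 1)) ^ 2 ≤ ε ^ 2 := pow_le_pow_left₀ (by positivity) h1 2
    calc gammaMax (clip V ρ) * ‖ν₀ - ν‖ ^ 2
        ≤ (β ^ (j + 1)) ^ 2 * gammaMin (clip V ρ) * ‖ν₀ - ν‖ ^ 2 :=
          mul_le_mul_of_nonneg_right h2 (by positivity)
      _ = (‖ν₀ - ν‖ * β ^ (j + 1)) ^ 2 * gammaMin (clip V ρ) := by ring
      _ ≤ ε ^ 2 * gammaMin (clip V ρ) := mul_le_mul_of_nonneg_right h3 hmin0.le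
  have hproj := hdir ν hν1 ε hε hclose
  have hbound := hs ν hν1
  set q := quadForm (clip V ρ) ν with hq
  have hqmin : gammaMin (clip V ρ) ≤ q := by simpa [hνn] using gammaMin_le_quadForm hW ν
  have hqmax : q ≤ gammaMax (clip V ρ) := by simpa [hνn] using quadForm_le_gammaMax hW ν
  have hq0 : 0 < q := hmin0.trans_le hqmin
  obtain ⟨k, hk1, hk2⟩ := exists_nat_pow_near ((one_le_div hρ).2 (hmin.trans hqmin)) hα
  have hlevel : cellLevel d β ε δ h j k ≤ Lfun α β ρ ε δ h V :=
    cellLevel_le_Lfun hd hα hβ hε.1 hmono hsum hj1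
      (hk1.trans (div_le_div_of_nonneg_right hqmax hρ.le))
  have hlevel0 := cellLevel_pos hd hβ hε.1 hδ hsum j k
  -- The factor `α` in the bound is spent here, through `q < ρ α^(k+1)`.
  have hyle : cellLevel d β ε δ h j k / (ρ * α ^ k) ≤ α / q * Lfun α β ρ ε δ h V := by
    have : 1 / (ρ * α ^ k) ≤ α / q := by
      rw [div_lt_iff₀ hρ, pow_succ] at hk2
      rw [div_le_div_iff₀ (by positivity) hq0]
      linarith
    calc cellLevel d β ε δ h j k / (ρ * α ^ k)
        = 1 / (ρ * α ^ k) * cellLevel d β ε δ h j k := by ring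
      _ ≤ α / q * Lfun α β ρ ε δ h V := mul_le_mul this hlevel hlevel0.le (by positivity)
  set y := cellLevel d β ε δ h j k
  have hu := hψ.conjInv_mono hψ' (y := y / (ρ * α ^ k)) (by positivity) hyle
  have hx1 := hxconj j k
  set u := conjInv lmax ψ (y / (ρ * α ^ k))
  have hinner : q * u ≤ inner ℝ ν s := by
    refine le_trans ?_ hproj
    have h1e : 0 < 1 - ε := by linarith [hε.2]
    rw [div_mul_eq_mul_div, div_le_iff₀ h1e] at hbound
    calc q * u = Real.sqrt q * (Real.sqrt q * u) := by
          rw [← mul_assoc, Real.mul_self_sqrt hq0.le]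
      _ ≤ Real.sqrt q * (selfNorm ρ V s * (1 - ε)) :=
          mul_le_mul_of_nonneg_left
            ((mul_le_mul_of_nonneg_left hu (Real.sqrt_nonneg q)).trans hbound) (Real.sqrt_nonneg q)
      _ = (1 - ε) * (Real.sqrt q * selfNorm ρ V s) := by ring
  refine ⟨j, ν, hνK, k, ?_⟩
  have h1 := mul_le_mul_of_nonneg_left hinner (hx j k).1
  -- Since `ψ ≥ 0`, replacing `V` by the larger `clip V ρ` only lowers the line statistic.
  have h2 := mul_le_mul_of_nonneg_left (quadForm_le_quadForm_clip hV ρ ν) (hψ.nonneg _ (hx j k))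
  have h3 : y ≤ q * (y / (ρ * α ^ k)) := by
    rw [le_div_iff₀ hρ] at hk1
    rw [← mul_div_assoc, le_div_iff₀ (by positivity), mul_comm q]
    exact mul_le_mul_of_nonneg_left (by linarith) hlevel0.le
  rw [← hx1] at h3
  calc y ≤ q * (u * x j k - ψ (x j k)) := h3
    _ = x j k * (q * u) - ψ (x j k) * q := by ring
    _ ≤ _ := sub_le_sub h1 h2

variable {Ω : Type*} {mΩ : MeasurableSpace Ω} {μ : Measure Ω} [IsProbabilityMeasure μ]
  {ℱ : Filtration ℕ mΩ}

/-- The directional form of the self-normalized bound, without assuming that `ψ` is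
super-Gaussian. -/
lemma measure_forall_direction_le (hd : 1 ≤ d) (hψ : IsCGFLike lmax ψ)
    (hψ' : DerivUnbounded lmax ψ)
    {S : ℕ → Ω → EuclideanSpace ℝ (Fin d)} {V : ℕ → Ω → Matrix (Fin d) (Fin d) ℝ}
    (hSV : IsSubPsi μ ℱ lmax ψ S V)
    (hα : 1 < α) (hβ : 1 < β) (hρ : 0 < ρ) (hε : ε ∈ Set.Ioo (0 : ℝ) 1)
    (hδ : δ ∈ Set.Ioo (0 : ℝ) 1) (hmono : MonotoneOn h (Set.Ici 0))
    (hsum : ∑' k : ℕ, (ENNReal.ofReal (h k))⁻¹ ≤ 1) :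
    μ {ω | ∃ t : ℕ, ∀ ν ∈ Metric.sphere (0 : EuclideanSpace ℝ (Fin d)) 1,
      Real.sqrt (quadForm (clip (V t ω) ρ) ν) / (1 - ε)
        * conjInv lmax ψ (α / quadForm (clip (V t ω) ρ) ν * Lfun α β ρ ε δ h (V t ω))
        ≤ selfNorm ρ (V t ω) (S t ω)} ≤ ENNReal.ofReal δ := by
  have hβ0 : 0 < β := by linarith
  have hα0 : 0 < α := by linarith
  have hε0 := hε.1
  choose K hK hKcard hKcov using fun j : ℕ =>
    exists_sphere_cover (d := d) (r := ε / β ^ (j + 1)) (by positivity)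
  -- The maximizer in `ψ*(u)` at `u = (ψ*)⁻¹(level / (ρ α^k))`: the optimal line for the variance `ρ
  -- α^k`.
  choose x hx hxconj using fun j k : ℕ => hψ.exists_eq_conj hψ'
    (conjInv lmax ψ (cellLevel d β ε δ h j k / (ρ * α ^ k)))
  have hxconj' : ∀ j k, conjInv lmax ψ (cellLevel d β ε δ h j k / (ρ * α ^ k)) * x j k - ψ (x j k)
      = cellLevel d β ε δ h j k / (ρ * α ^ k) := fun j k => by
    have := cellLevel_pos hd hβ hε.1 hδ hsum j k
    rw [hxconj, hψ.conj_conjInv hψ' (by positivity)]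
  calc _ ≤ μ (⋃ j, ⋃ ν ∈ K j, ⋃ k, {ω | ∃ t, cellLevel d β ε δ h j k
            ≤ x j k * inner ℝ ν (S t ω) - ψ (x j k) * quadForm (V t ω) ν}) := by
        refine measure_mono ?_
        rintro ω ⟨t, ht⟩
        obtain ⟨j, ν, hν, k, hc⟩ := exists_line_crossing hd hψ hψ' hα hβ hρ hε hδ hmono hsum
          hK hKcov hx hxconj' (hSV.posSemidef t ω) ht
        simp only [Set.mem_iUnion]
        exact ⟨j, ν, hν, k, t, hc⟩
    _ ≤ ∑' j, ∑ ν ∈ K j, ∑' k, ENNReal.ofReal (Real.exp (-cellLevel d β ε δ h j k)) := by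
        refine (measure_iUnion_le _).trans (ENNReal.tsum_le_tsum fun j => ?_)
        refine (measure_biUnion_finset_le _ _).trans (Finset.sum_le_sum fun ν hν => ?_)
        refine (measure_iUnion_le _).trans (ENNReal.tsum_le_tsum fun k => ?_)
        exact (hSV.projected ν (hK j ν hν)).measure_line_crossing_le (hx j k) _
    _ = ∑' j : ℕ, (sphereCov d (ε / β ^ (j + 1)) : ℝ≥0∞) *
          ∑' k : ℕ, ENNReal.ofReal (Real.exp (-cellLevel d β ε δ h j k)) := by
        simp only [Finset.sum_const, nsmul_eq_mul, hKcard]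
    _ ≤ ENNReal.ofReal δ := tsum_exp_neg_cellLevel_le hd hβ hε.1 hδ hsum

end Main

end SelfNormalized

theorem theorem4p1 {Ω : Type*} {mΩ : MeasurableSpace Ω} (μ : Measure Ω) [IsProbabilityMeasure μ]
    (ℱ : Filtration ℕ mΩ) (d : ℕ) (hd : 1 ≤ d)
    (lmax : EReal) (ψ : ℝ → ℝ)
    (hψ : SelfNormalized.IsCGFLike lmax ψ) (hψ' : SelfNormalized.DerivUnbounded lmax ψ)
    (S : ℕ → Ω → EuclideanSpace ℝ (Fin d)) (V : ℕ → Ω → Matrix (Fin d) (Fin d) ℝ)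
    (hSV : SelfNormalized.IsSubPsi μ ℱ lmax ψ S V)
    (α β ρ ε δ : ℝ) (hα : 1 < α) (hβ : 1 < β) (hρ : 0 < ρ)
    (hε : ε ∈ Set.Ioo (0 : ℝ) 1) (hδ : δ ∈ Set.Ioo (0 : ℝ) 1)
    (h : ℝ → ℝ) (hmono : MonotoneOn h (Set.Ici 0))
    (hsum : ∑' k : ℕ, (ENNReal.ofReal (h k))⁻¹ ≤ 1) :
    (SelfNormalized.IsSuperGaussian lmax ψ →
      μ {ω | ∃ t : ℕ,
          Real.sqrt (SelfNormalized.gammaMin (SelfNormalized.clip (V t ω) ρ)) / (1 - ε)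
            * SelfNormalized.conjInv lmax ψ
                (α / SelfNormalized.gammaMin (SelfNormalized.clip (V t ω) ρ)
                  * SelfNormalized.Lfun α β ρ ε δ h (V t ω))
          ≤ SelfNormalized.selfNorm ρ (V t ω) (S t ω)} ≤ ENNReal.ofReal δ) ∧
    μ {ω | ∃ t : ℕ,
        (⨆ ν : Metric.sphere (0 : EuclideanSpace ℝ (Fin d)) 1,
          Real.sqrt (SelfNormalized.quadForm (SelfNormalized.clip (V t ω) ρ) ν) / (1 - ε)
            * SelfNormalized.conjInv lmax ψ
                (α / SelfNormalized.quadForm (SelfNormalized.clip (V t ω) ρ) ν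
                  * SelfNormalized.Lfun α β ρ ε δ h (V t ω)))
        ≤ SelfNormalized.selfNorm ρ (V t ω) (S t ω)} ≤ ENNReal.ofReal δ := by
  have h1ε : 0 < 1 - ε := by linarith [hε.2]
  have hα0 : 0 < α := by linarith
  refine ⟨fun hsg => ?_, ?_⟩
  all_goals
    refine le_trans (measure_mono ?_)
      (SelfNormalized.measure_forall_direction_le hd hψ hψ' hSV hα hβ hρ hε hδ hmono hsum)
    rintro ω ⟨t, ht⟩
    refine ⟨t, fun ν hν => le_trans ?_ ht⟩
    have hνn : ‖ν‖ = 1 := by simpa using hν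
    have hV := hSV.posSemidef t ω
    have hW := SelfNormalized.isSelfAdjoint_clip (V t ω) ρ
    have hmin0 := hρ.trans_le (SelfNormalized.le_gammaMin_clip hd hV ρ)
    have hL := SelfNormalized.Lfun_pos hd hα hβ hρ hε.1 hδ hmono hsum hV
  · have hqmin : SelfNormalized.gammaMin (SelfNormalized.clip (V t ω) ρ) ≤
        SelfNormalized.quadForm (SelfNormalized.clip (V t ω) ρ) ν := by
      simpa [hνn] using SelfNormalized.gammaMin_le_quadForm hW ν
    rw [div_mul_eq_mul_div, div_mul_eq_mul_div, div_mul_eq_mul_div, div_mul_eq_mul_div]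
    exact div_le_div_of_nonneg_right
      (hψ.sqrt_mul_conjInv_anti hψ' hsg (mul_pos hα0 hL) hmin0 hqmin) h1ε.le
  · refine le_ciSup (f := fun ν : Metric.sphere (0 : EuclideanSpace ℝ (Fin d)) 1 =>
      Real.sqrt (SelfNormalized.quadForm (SelfNormalized.clip (V t ω) ρ) ν) / (1 - ε)
        * SelfNormalized.conjInv lmax ψ
          (α / SelfNormalized.quadForm (SelfNormalized.clip (V t ω) ρ) ν
            * SelfNormalized.Lfun α β ρ ε δ h (V t ω))) ?_ ⟨ν, hν⟩
    -- A real `⨆` over an unbounded family is `0`, so a bound is required: `q ≤ γ_max` in the square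
    -- root and `q ≥ γ_min` in the argument of `(ψ*)⁻¹`.
    refine ⟨Real.sqrt (SelfNormalized.gammaMax (SelfNormalized.clip (V t ω) ρ)) / (1 - ε)
      * SelfNormalized.conjInv lmax ψ
        (α / SelfNormalized.gammaMin (SelfNormalized.clip (V t ω) ρ)
          * SelfNormalized.Lfun α β ρ ε δ h (V t ω)), ?_⟩
    rintro _ ⟨⟨v, hv⟩, rfl⟩
    have hvn : ‖v‖ = 1 := by simpa using hv
    have hqmin : SelfNormalized.gammaMin (SelfNormalized.clip (V t ω) ρ) ≤
        SelfNormalized.quadForm (SelfNormalized.clip (V t ω) ρ) v := by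
      simpa [hvn] using SelfNormalized.gammaMin_le_quadForm hW v
    have hqmax : SelfNormalized.quadForm (SelfNormalized.clip (V t ω) ρ) v ≤
        SelfNormalized.gammaMax (SelfNormalized.clip (V t ω) ρ) := by
      simpa [hvn] using SelfNormalized.quadForm_le_gammaMax hW v
    have hq0 := hmin0.trans_le hqmin
    exact mul_le_mul (div_le_div_of_nonneg_right (Real.sqrt_le_sqrt hqmax) h1ε.le)
      (hψ.conjInv_mono hψ' (by positivity)
        (mul_le_mul_of_nonneg_right (div_le_div_of_nonneg_left hα0.le hmin0 hqmin) hL.le))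
      (hψ.conjInv_nonneg hψ' (by positivity)) (by positivity)
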